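/- Consider a multirotor UAV of mass $m_{UAV}>0$ with a payload of mass $m_{PL}\ge 0$; let $m_{tot}=m_{UAV}+m_{PL}$, let $H_{tot}=\mathrm{diag}(H_{xx},H_{yy},H_{zz})$ be the total inertia with positive entries, and let $g>0$. The payload and the controlled point lie on the body-fixed vertical axis at signed heights $z_{PL},z_{POI}\in\mathbb R$. Put $\alpha=z_{POI}-\frac{m_{PL}}{m_{tot}}z_{PL}$. For weights $q_1,\dots,q_4>0$ put $$\hat q_1=\frac{m_{PL}m_{UAV}z_{PL}^2+H_{yy}m_{tot}}{m_{tot}}\,q_1,\quad \hat q_2=\frac{m_{PL}m_{UAV}z_{PL}^2+H_{xx}m_{tot}}{m_{tot}}\,q_2,\quad \hat q_3=m_{tot}\,q_3,\quad \hat q_4=H_{zz}\,q_4 .$$ The linearized dynamics decouple into four subsystems $\dot x_i=A_ix_i+B_iu_i$, $y_i=C_ix_i$, where $C_i$ selects the first state, $$A_1=\begin{bmatrix}0&1&0&0\\0&0&g&0\\0&0&0&1\\0&0&0&0\end{bmatrix},\; B_1=\begin{bmatrix}0\\ \alpha\\0\\1\end{bmatrix},\quad A_2=\begin{bmatrix}0&1&0&0\\0&0&-g&0\\0&0&0&1\\0&0&0&0\end{bmatrix},\;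 B_2=\begin{bmatrix}0\\-\alpha\\0\\1\end{bmatrix},\quad A_3=A_4=\begin{bmatrix}0&1\\0&0\end{bmatrix},\; B_3=B_4=\begin{bmatrix}0\\1\end{bmatrix}.$$ For each $i$ the algebraic Riccati equation $A_i^\top P+PA_i-PB_iB_i^\top P+\hat q_i^2C_i^\top C_i=0$ (cost $\int_0^\infty \hat q_i^2y_i^2+u_i^2\,dt$) has exactly one positive semidefinite solution $P_i$. Under the LQR law $u_i=-B_i^\top P_ix_i$ the closed loop $\dot x_i=(A_i-B_iB_i^\top P_i)x_i+B_id$ with disturbance $d$ and performance output $z_i=(\hat q_iy_i,u_i)$ is asymptotically stable (all eigenvalues of $A_i-B_iB_i^\top P_i$ have negative real part). Let $\mathcal H_{2,i}$ be its $\mathcal H_2$-norm, i.e. the $L^2(0,\infty)$-norm of the impulse response from $d$ to $z_i$. Then for $i\in\{1,2\}$ $$\mathcal H_{2,i}^2=\frac{2a_i-b_i+\sigma_i}{\hat q_i\sqrt{\hat q_i}\,\sqrt{a_i-b_i+\sigma_i}},\qquad a_i=\sqrt{2g\hat q_i^7},\quad b_i=\alpha\hat q_i^4,\quad \sigma_i=\sqrt{(a_i-b_i)^2+a_i^2},$$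 and for $i\in\{3,4\}$ $$\mathcal H_{2,i}^2=\sqrt{2\hat q_i}.$$ -/

import Mathlib

open scoped Matrix

noncomputable section

namespace UAVPayload

/-- Physical parameters of a multirotor UAV with a rigidly attached payload. The total inertia is
`diag (Hxx, Hyy, Hzz)`, and the payload and the point of interest lie on the body-fixed vertical
axis through the centre of gravity of the UAV body, at the signed heights `zPL` and `zPOI`.
The numbers `q 0, q 1, q 2, q 3` are the output weights `q₁, q₂, q₃, q₄`. -/
structure Params where
  g : ℝ
  mUAV : ℝ
  mPL : ℝ
  Hxx : ℝ
  Hyy : ℝ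
  Hzz : ℝ
  zPL : ℝ
  zPOI : ℝ
  q : Fin 4 → ℝ
  g_pos : 0 < g
  mUAV_pos : 0 < mUAV
  mPL_nonneg : 0 ≤ mPL
  Hxx_pos : 0 < Hxx
  Hyy_pos : 0 < Hyy
  Hzz_pos : 0 < Hzz
  q_pos : ∀ i, 0 < q i

namespace Params

variable (S : Params)

/-- Total mass. -/
def mtot : ℝ := S.mUAV + S.mPL

/-- Signed height of the point of interest above the total centre of gravity. -/
def alpha : ℝ := S.zPOI - S.mPL / S.mtot * S.zPL

/-- The reciprocals of the diagonal entries of the input scaling, in the order of the subsystems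
`x, y, z, ψ`, so that the scaled weight is this number times the original weight. -/
def inputScale : Fin 4 → ℝ :=
  ![(S.mPL * S.mUAV * S.zPL ^ 2 + S.Hyy * S.mtot) / S.mtot,
    (S.mPL * S.mUAV * S.zPL ^ 2 + S.Hxx * S.mtot) / S.mtot,
    S.mtot,
    S.Hzz]

/-- Scaled output weights `q̂₁, q̂₂, q̂₃, q̂₄`. -/
def qhat (i : Fin 4) : ℝ := S.inputScale i * S.q i

/-- `a_i = √(2 g q̂_i ^ 7)`. -/
def a (i : Fin 4) : ℝ := √(2 * S.g * S.qhat i ^ 7)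

/-- `b_i = α q̂_i ^ 4`. -/
def b (i : Fin 4) : ℝ := S.alpha * S.qhat i ^ 4

/-- `σ_i = √((a_i - b_i)² + a_i²)`. -/
def sigma (i : Fin 4) : ℝ := √((S.a i - S.b i) ^ 2 + S.a i ^ 2)

end Params

/-- A linear time-invariant plant `x' = A x + B u`, `y = C x` with scalar input and output,
together with the weight `w` of the running cost `w² y² + u²`. -/
structure Plant (n : ℕ) where
  A : Matrix (Fin n) (Fin n) ℝ
  B : Matrix (Fin n) (Fin 1) ℝ
  C : Matrix (Fin 1) (Fin n) ℝ
  w : ℝ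

/-- Subsystem 1: state `(x_POI, x_POI', θ, ω_y)`, output `x_POI`. -/
def subsystem1 (S : Params) : Plant 4 where
  A := !![0, 1, 0, 0; 0, 0, S.g, 0; 0, 0, 0, 1; 0, 0, 0, 0]
  B := !![0; S.alpha; 0; 1]
  C := !![1, 0, 0, 0]
  w := S.qhat 0

/-- Subsystem 2: state `(y_POI, y_POI', φ, ω_x)`, output `y_POI`. -/
def subsystem2 (S : Params) : Plant 4 where
  A := !![0, 1, 0, 0; 0, 0, -S.g, 0; 0, 0, 0, 1; 0, 0, 0, 0]
  B := !![0; -S.alpha; 0; 1]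
  C := !![1, 0, 0, 0]
  w := S.qhat 1

/-- Subsystem 3: state `(z_POI, z_POI')`, output `z_POI`. -/
def subsystem3 (S : Params) : Plant 2 where
  A := !![0, 1; 0, 0]
  B := !![0; 1]
  C := !![1, 0]
  w := S.qhat 2

/-- Subsystem 4: state `(ψ, ω_z)`, output `ψ`. -/
def subsystem4 (S : Params) : Plant 2 where
  A := !![0, 1; 0, 0]
  B := !![0; 1]
  C := !![1, 0]
  w := S.qhat 3

/-- All (complex) eigenvalues of the real matrix `A` have negative real part. -/
def IsHurwitz {n : ℕ} (A : Matrix (Fin n) (Fin n) ℝ) : Prop :=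
  ∀ μ ∈ spectrum ℂ (A.map (algebraMap ℝ ℂ)), μ.re < 0

/-- Squared Frobenius norm of the impulse response `C e^{tA} B` of `x' = A x + B d`, `z = C x`. -/
def impulseEnergy {n m p : ℕ} (A : Matrix (Fin n) (Fin n) ℝ) (B : Matrix (Fin n) (Fin m) ℝ)
    (C : Matrix (Fin p) (Fin n) ℝ) (t : ℝ) : ℝ :=
  ((C * NormedSpace.exp (t • A) * B)ᵀ * (C * NormedSpace.exp (t • A) * B)).trace

/-- `h` is the `H₂`-norm of the stable system `x' = A x + B d`, `z = C x`: the matrix `A` is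
Hurwitz and `h` is the `L²`-norm over `[0, ∞)` of the impulse response from `d` to `z`. -/
def HasH2Norm {n m p : ℕ} (A : Matrix (Fin n) (Fin n) ℝ) (B : Matrix (Fin n) (Fin m) ℝ)
    (C : Matrix (Fin p) (Fin n) ℝ) (h : ℝ) : Prop :=
  IsHurwitz A ∧
    MeasureTheory.IntegrableOn (impulseEnergy A B C) (Set.Ioi 0) ∧
    h = √(∫ t in Set.Ioi (0 : ℝ), impulseEnergy A B C t)

namespace Plant

variable {n : ℕ} (G : Plant n)

/-- `P` is a positive semidefinite solution of the algebraic Riccati equation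
`Aᵀ P + P A - P B R⁻¹ Bᵀ P + w² Cᵀ C = 0` with `R = 1`. -/
def IsRiccatiSolution (P : Matrix (Fin n) (Fin n) ℝ) : Prop :=
  P.PosSemidef ∧ G.Aᵀ * P + P * G.A - P * G.B * G.Bᵀ * P + G.w ^ 2 • (G.Cᵀ * G.C) = 0

/-- State matrix `A - B Bᵀ P` of the loop closed by the feedback `u = -Bᵀ P x`. -/
def closedLoopA (P : Matrix (Fin n) (Fin n) ℝ) : Matrix (Fin n) (Fin n) ℝ :=
  G.A - G.B * (G.Bᵀ * P)

/-- Output matrix of the performance output `z = (w y, u)` under the feedback `u = -Bᵀ P x`. -/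
def closedLoopC (P : Matrix (Fin n) (Fin n) ℝ) : Matrix (Fin 2) (Fin n) ℝ :=
  Matrix.of ![(G.w • G.C) 0, (-(G.Bᵀ * P)) 0]

/-- The Riccati equation of `G` has exactly one positive semidefinite solution `P`, and the loop
closed by the LQR law `u = -Bᵀ P x`, with the disturbance entering additively at the input of the
plant and with performance output `z = (w y, u)`, is stable with `H₂`-norm `h`. -/
def HasLQRH2Norm (h : ℝ) : Prop :=
  ∃ P, G.IsRiccatiSolution P ∧ (∀ P', G.IsRiccatiSolution P' → P' = P) ∧
    HasH2Norm (G.closedLoopA P) G.B (G.closedLoopC P) h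

end Plant

end UAVPayload

end

/-! For a Riccati solution `P` with closed loop `A`, the Riccati equation is the Lyapunov equation
of `A`, so `e^{tAᵀ} P e^{tA}` has derivative minus the output energy density. If `A` is Hurwitz,
integrating over `[0, ∞)` gives the squared `H₂`-norm `tr (Bᵀ P B)`
(`IsRiccatiSolution.hasLQRH2Norm`). Observability makes every positive semidefinite solution
stabilizing, and the difference of two such solutions solves a homogeneous Sylvester equation
between Hurwitz matrices, hence vanishes.

It remains to exhibit `P`. For the quadruple integrators, the stable factor of `s⁸ + q²(γ + α s²)²`
is `(s² + c s + d)(s² + c̄ s + d̄)` with `c = ((r + u) + i(r - u))/2` and `d = ru(1 + i)/2`. In the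
parameters `r, u > 0` everything is rational: `qγ = r²u²/2`, `qα = (u² + 2ur - r²)/2`, and `tr (Bᵀ P
B) = r + u`. Solving for `r` and `u` yields the stated radicals. -/

open scoped Matrix
namespace UAVPayload

/-! ### Decay of the matrix exponential of a Hurwitz matrix -/

section MatrixExp

open Filter Topology NormedSpace

attribute [local instance] Matrix.linftyOpNormedRing Matrix.linftyOpNormedAlgebra
  Matrix.linftyOpNormedAddCommGroup Matrix.linftyOpNormedSpace

variable {n : ℕ}

theorem hasSum_exp_matrix (M : Matrix (Fin n) (Fin n) ℂ) :
    HasSum (fun k : ℕ => ((k.factorial : ℂ)⁻¹) • M ^ k) (exp M) :=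
  exp_series_hasSum_exp' (𝕂 := ℂ) M

theorem map_exp_matrix (A : Matrix (Fin n) (Fin n) ℝ) :
    (exp A).map (algebraMap ℝ ℂ) = exp (A.map (algebraMap ℝ ℂ)) := by
  refine map_exp (algebraMap ℝ ℂ).mapMatrix ?_ A
  exact continuous_id.matrix_map Complex.continuous_ofReal

theorem hasDerivAt_exp_matrix (A : Matrix (Fin n) (Fin n) ℝ) (t : ℝ) :
    HasDerivAt (fun t : ℝ => exp (t • A)) (exp (t • A) * A) t :=
  hasDerivAt_exp_smul_const (𝕂 := ℝ) A t

theorem hasDerivAt_exp_matrix' (A : Matrix (Fin n) (Fin n) ℝ) (t : ℝ) :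
    HasDerivAt (fun t : ℝ => exp (t • A)) (A * exp (t • A)) t :=
  hasDerivAt_exp_smul_const' (𝕂 := ℝ) A t

/-- The derivative of `e^{tA₁ᵀ} D e^{tA₂}` is `e^{tA₁ᵀ} (A₁ᵀ D + D A₂) e^{tA₂}`. -/
theorem hasDerivAt_exp_transpose_mul_mul_exp (A₁ A₂ D : Matrix (Fin n) (Fin n) ℝ) (t : ℝ) :
    HasDerivAt (fun t : ℝ => (exp (t • A₁))ᵀ * D * exp (t • A₂))
      ((exp (t • A₁))ᵀ * (A₁ᵀ * D + D * A₂) * exp (t • A₂)) t := by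
  simp only [← Matrix.exp_transpose, Matrix.transpose_smul]
  have h := ((hasDerivAt_exp_matrix A₁ᵀ t).mul_const D).mul (hasDerivAt_exp_matrix' A₂ t)
  refine h.congr_deriv ?_
  noncomm_ring

theorem exp_smul_mulVec_of_pow_mulVec_eq_zero (N : Matrix (Fin n) (Fin n) ℂ) (k : ℕ)
    (v : Fin n → ℂ) (h : (N ^ k) *ᵥ v = 0) (t : ℂ) :
    exp (t • N) *ᵥ v =
      ∑ j ∈ Finset.range k, (((j.factorial : ℂ)⁻¹) * t ^ j) • (N ^ j *ᵥ v) := by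
  have hs := (hasSum_exp_matrix (t • N)).map
    (Matrix.mulVecBilin ℂ ℂ |>.flip v : Matrix (Fin n) (Fin n) ℂ →ₗ[ℂ] (Fin n → ℂ))
    (Continuous.matrix_mulVec continuous_id continuous_const)
  have hz : ∀ j ∉ Finset.range k, (((j.factorial : ℂ)⁻¹) * t ^ j) • (N ^ j *ᵥ v) = 0 := by
    intro j hj
    obtain ⟨i, rfl⟩ := Nat.exists_eq_add_of_le' (not_lt.1 (mt Finset.mem_range.2 hj))
    rw [pow_add N, ← Matrix.mulVec_mulVec, h, Matrix.mulVec_zero, smul_zero]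
  refine hs.unique ?_
  convert hasSum_sum_of_ne_finset_zero (L := .unconditional ℕ) hz using 1
  funext j
  simp [smul_pow, smul_smul]

theorem exp_smul_eq_smul_exp_sub (M : Matrix (Fin n) (Fin n) ℂ) (μ t : ℂ) :
    exp (t • M) = Complex.exp (t * μ) • exp (t • (M - μ • 1)) := by
  have h1 : t • M = (t * μ) • (1 : Matrix (Fin n) (Fin n) ℂ) + t • (M - μ • 1) := by
    rw [smul_sub, smul_smul]; abel
  have h2 : exp ((t * μ) • (1 : Matrix (Fin n) (Fin n) ℂ)) = Complex.exp (t * μ) • 1 := by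
    have := (algebraMap_exp_comm (𝕂 := ℂ) (𝔸 := Matrix (Fin n) (Fin n) ℂ) (t * μ)).symm
    rwa [Algebra.algebraMap_eq_smul_one, Algebra.algebraMap_eq_smul_one,
      ← Complex.exp_eq_exp_ℂ] at this
  conv_lhs => rw [h1]
  rw [Matrix.exp_add_of_commute _ _ ((Commute.one_left _).smul_left _), h2, smul_mul_assoc,
    one_mul]

theorem tendsto_exp_mul_pow_of_re_neg {μ : ℂ} (hμ : μ.re < 0) (j : ℕ) :
    Tendsto (fun t : ℝ => Complex.exp (t * μ) * (t : ℂ) ^ j) atTop (𝓝 0) := by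
  rw [tendsto_zero_iff_norm_tendsto_zero]
  have h := (Real.tendsto_pow_mul_exp_neg_atTop_nhds_zero j).comp
    (tendsto_id.const_mul_atTop (neg_pos.2 hμ))
  have h2 := h.const_mul (((-μ.re) ^ j)⁻¹)
  rw [mul_zero] at h2
  refine h2.congr' ?_
  filter_upwards [eventually_ge_atTop 0] with t ht
  have : (-μ.re) ^ j ≠ 0 := pow_ne_zero _ (neg_pos.2 hμ).ne'
  simp only [Function.comp, id, norm_mul, norm_pow, Complex.norm_real, Complex.norm_exp,
    Real.norm_of_nonneg ht, mul_pow]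
  rw [← mul_assoc, inv_mul_cancel_left₀ this, mul_comm]
  congr 2
  simp
  ring

/-- On a generalized eigenvector the exponential series of `M - μ` terminates, so `e^{tM} v` is
`e^{tμ}` times a polynomial in `t`. -/
theorem tendsto_exp_smul_mulVec {M : Matrix (Fin n) (Fin n) ℂ} {μ : ℂ} (hμ : μ.re < 0) (k : ℕ)
    (v : Fin n → ℂ) (h : ((M - μ • 1) ^ k) *ᵥ v = 0) :
    Tendsto (fun t : ℝ => exp ((t : ℂ) • M) *ᵥ v) atTop (𝓝 0) := by
  have key : ∀ t : ℝ, exp ((t : ℂ) • M) *ᵥ v = ∑ j ∈ Finset.range k,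
      (Complex.exp (t * μ) * (t : ℂ) ^ j) • (((j.factorial : ℂ)⁻¹) • ((M - μ • 1) ^ j *ᵥ v)) := by
    intro t
    rw [exp_smul_eq_smul_exp_sub M μ, Matrix.smul_mulVec,
      exp_smul_mulVec_of_pow_mulVec_eq_zero _ k v h, Finset.smul_sum]
    refine Finset.sum_congr rfl fun j _ => ?_
    rw [smul_smul, smul_smul]
    congr 1
    ring
  simp only [key]
  rw [← Finset.sum_const_zero (s := Finset.range k)]
  refine tendsto_finsetSum _ fun j _ => ?_
  simpa using (tendsto_exp_mul_pow_of_re_neg hμ j).smul_const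
    (((j.factorial : ℂ)⁻¹) • ((M - μ • 1) ^ j *ᵥ v))

theorem tendsto_exp_smul_zero_of_spectrum {M : Matrix (Fin n) (Fin n) ℂ}
    (hM : ∀ μ ∈ spectrum ℂ M, μ.re < 0) :
    Tendsto (fun t : ℝ => exp ((t : ℂ) • M)) atTop (𝓝 0) := by
  have key : ∀ v : Fin n → ℂ, Tendsto (fun t : ℝ => exp ((t : ℂ) • M) *ᵥ v) atTop (𝓝 0) := by
    intro v
    -- Generalized eigenspaces span over `ℂ`, so decay need only be checked on each of them.
    have hv : v ∈ ⨆ μ, Module.End.maxGenEigenspace (Matrix.toLin' M) μ := by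
      rw [Module.End.iSup_maxGenEigenspace_eq_top]; trivial
    induction hv using Submodule.iSup_induction' with
    | mem μ x hx =>
      rcases eq_or_ne x 0 with rfl | hx0
      · simp
      obtain ⟨k, hk⟩ := Module.End.mem_maxGenEigenspace _ _ _ |>.1 hx
      have hμ : Module.End.HasEigenvalue (Matrix.toLin' M) μ := by
        refine Module.End.hasEigenvalue_of_hasGenEigenvalue (k := k) fun hb => hx0 ?_
        have : x ∈ Module.End.genEigenspace (Matrix.toLin' M) μ k :=
          Module.End.mem_genEigenspace_nat.2 hk
        rw [hb] at this
        simpa using this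
      have hs : μ ∈ spectrum ℂ M := by
        rw [← Matrix.spectrum_toLin' M]
        exact hμ.mem_spectrum
      refine tendsto_exp_smul_mulVec (hM μ hs) k x ?_
      have e : Matrix.toLin' ((M - μ • 1) ^ k) = (Matrix.toLin' M - μ • 1) ^ k := by
        rw [Matrix.toLin'_pow, map_sub, map_smul, Matrix.toLin'_one]; rfl
      rw [← Matrix.toLin'_apply, e, hk]
    | zero => simp
    | add x y _ _ hx hy =>
      simp only [Matrix.mulVec_add]
      simpa using hx.add hy
  refine tendsto_pi_nhds.2 fun i => tendsto_pi_nhds.2 fun j => ?_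
  have := (tendsto_pi_nhds.1 (key (Pi.single j 1))) i
  simpa using this

theorem IsHurwitz.tendsto_exp {A : Matrix (Fin n) (Fin n) ℝ} (hA : IsHurwitz A) :
    Tendsto (fun t : ℝ => exp (t • A)) atTop (𝓝 0) := by
  have h := tendsto_exp_smul_zero_of_spectrum hA
  refine tendsto_pi_nhds.2 fun i => tendsto_pi_nhds.2 fun j => ?_
  have hij := (Complex.continuous_re.tendsto _).comp
    (tendsto_pi_nhds.1 (tendsto_pi_nhds.1 h i) j)
  refine Tendsto.congr (fun t => ?_) hij
  have e : (t : ℂ) • A.map (algebraMap ℝ ℂ) = (t • A).map (algebraMap ℝ ℂ) := by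
    ext; simp
  rw [Function.comp, e, ← map_exp_matrix]
  simp

/-- A matrix `D` with `A₁ᵀ D + D A₂ = 0` for Hurwitz matrices `A₁`, `A₂` vanishes. -/
theorem IsHurwitz.eq_zero_of_sylvester {A₁ A₂ D : Matrix (Fin n) (Fin n) ℝ} (h₁ : IsHurwitz A₁)
    (h₂ : IsHurwitz A₂) (h : A₁ᵀ * D + D * A₂ = 0) : D = 0 := by
  have hd : ∀ t, HasDerivAt (fun t : ℝ => (exp (t • A₁))ᵀ * D * exp (t • A₂)) 0 t := by
    intro t
    simpa [h] using hasDerivAt_exp_transpose_mul_mul_exp A₁ A₂ D t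
  -- The product is constant, equal to its value `D` at `t = 0`, while its outer factors tend to
  -- zero.
  have hc : ∀ t : ℝ, (exp (t • A₁))ᵀ * D * exp (t • A₂) = D := by
    intro t
    have := is_const_of_deriv_eq_zero (fun t => (hd t).differentiableAt) (fun t => (hd t).deriv)
      t 0
    simpa using this
  have hl : Tendsto (fun t : ℝ => (exp (t • A₁))ᵀ * D * exp (t • A₂)) atTop (𝓝 0) := by
    have hT : Tendsto (fun t : ℝ => (exp (t • A₁))ᵀ) atTop (𝓝 0) := by
      simpa [Function.comp_def] using ((continuous_id.matrix_transpose).tendsto _).comp h₁.tendsto_exp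
    simpa using (hT.mul_const D).mul h₂.tendsto_exp
  simp only [hc] at hl
  exact tendsto_nhds_unique tendsto_const_nhds hl

end MatrixExp
-- Riccati solutions: stability, uniqueness and the `H₂`-norm
namespace Plant

variable {n : ℕ} {G : Plant n}

/-- The pair `(C, A)` is observable (Kalman). -/
def IsObservable (G : Plant n) : Prop :=
  ∀ x : Fin n → ℝ, (∀ k : ℕ, (G.C * G.A ^ k) *ᵥ x = 0) → x = 0

theorem IsRiccatiSolution.transpose_eq {P : Matrix (Fin n) (Fin n) ℝ}
    (h : G.IsRiccatiSolution P) : Pᵀ = P := by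
  have := h.1.isHermitian
  rwa [Matrix.IsHermitian, Matrix.conjTranspose_eq_transpose_of_trivial] at this

theorem closedLoopC_transpose_mul_self (P : Matrix (Fin n) (Fin n) ℝ) :
    (G.closedLoopC P)ᵀ * G.closedLoopC P =
      G.w ^ 2 • (G.Cᵀ * G.C) + (G.Bᵀ * P)ᵀ * (G.Bᵀ * P) := by
  ext i j
  simp only [closedLoopC, Matrix.mul_apply, Fin.sum_univ_two, Matrix.transpose_apply,
    Matrix.of_apply, Matrix.add_apply, Matrix.smul_apply, Finset.univ_unique, Finset.sum_singleton,
    Matrix.cons_val_zero, Matrix.cons_val_one, smul_eq_mul,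
    Fin.default_eq_zero, Fin.isValue, Matrix.neg_apply]
  ring

/-- A Riccati solution solves the Lyapunov equation of its closed loop. -/
theorem IsRiccatiSolution.lyapunov {P : Matrix (Fin n) (Fin n) ℝ} (h : G.IsRiccatiSolution P) :
    (G.closedLoopA P)ᵀ * P + P * G.closedLoopA P = -((G.closedLoopC P)ᵀ * G.closedLoopC P) := by
  rw [closedLoopC_transpose_mul_self, eq_neg_iff_add_eq_zero, ← h.2]
  simp only [closedLoopA, Matrix.transpose_sub, Matrix.transpose_mul, Matrix.transpose_transpose,
    h.transpose_eq, Matrix.sub_mul, Matrix.mul_sub, Matrix.mul_assoc]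
  abel

theorem dotProduct_transpose_mul_mulVec {m k : ℕ} (M : Matrix (Fin m) (Fin n) ℝ)
    (N : Matrix (Fin m) (Fin k) ℝ) (x : Fin n → ℝ) (y : Fin k → ℝ) :
    x ⬝ᵥ ((Mᵀ * N) *ᵥ y) = (M *ᵥ x) ⬝ᵥ (N *ᵥ y) := by
  rw [← Matrix.mulVec_mulVec, Matrix.dotProduct_mulVec, Matrix.vecMul_transpose]

theorem IsRiccatiSolution.dotProduct_lyapunov {P : Matrix (Fin n) (Fin n) ℝ}
    (h : G.IsRiccatiSolution P) (x : Fin n → ℝ) :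
    2 * (x ⬝ᵥ (P *ᵥ (G.closedLoopA P *ᵥ x))) =
      -((G.closedLoopC P *ᵥ x) ⬝ᵥ (G.closedLoopC P *ᵥ x)) := by
  have e := congrArg (fun M => x ⬝ᵥ (M *ᵥ x)) h.lyapunov
  simp only [Matrix.add_mulVec, Matrix.neg_mulVec, dotProduct_add, dotProduct_neg,
    dotProduct_transpose_mul_mulVec] at e
  rw [← e, Matrix.mulVec_mulVec, dotProduct_comm (G.closedLoopA P *ᵥ x),
    ← dotProduct_transpose_mul_mulVec, h.transpose_eq]
  ring

theorem dotProduct_riccati_comm {P : Matrix (Fin n) (Fin n) ℝ} (hP : Pᵀ = P) (x y : Fin n → ℝ) :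
    x ⬝ᵥ (P *ᵥ y) = y ⬝ᵥ (P *ᵥ x) := by
  rw [Matrix.dotProduct_mulVec, ← Matrix.mulVec_transpose, hP, dotProduct_comm]

theorem closedLoopC_mulVec_zero (P : Matrix (Fin n) (Fin n) ℝ) (x : Fin n → ℝ) :
    (G.closedLoopC P *ᵥ x) 0 = G.w * (G.C *ᵥ x) 0 := by
  simp [closedLoopC, Matrix.mulVec, dotProduct, Finset.mul_sum, mul_assoc]

theorem closedLoopC_mulVec_one (P : Matrix (Fin n) (Fin n) ℝ) (x : Fin n → ℝ) :
    (G.closedLoopC P *ᵥ x) 1 = -((G.Bᵀ * P) *ᵥ x) 0 := by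
  simp [closedLoopC, Matrix.mulVec, dotProduct]

theorem output_eq_zero_of_closedLoopC (hw : G.w ≠ 0) {P : Matrix (Fin n) (Fin n) ℝ}
    {x : Fin n → ℝ} (hx : G.closedLoopC P *ᵥ x = 0) :
    G.C *ᵥ x = 0 ∧ G.closedLoopA P *ᵥ x = G.A *ᵥ x := by
  have h0 := congrFun hx 0
  have h1 := congrFun hx 1
  rw [closedLoopC_mulVec_zero, Pi.zero_apply] at h0
  rw [closedLoopC_mulVec_one, Pi.zero_apply, neg_eq_zero] at h1
  have hK : (G.Bᵀ * P) *ᵥ x = 0 := by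
    funext i; rw [Subsingleton.elim i 0, h1]; rfl
  refine ⟨?_, ?_⟩
  · funext i; rw [Subsingleton.elim i 0]; exact (mul_eq_zero.1 h0).resolve_left hw
  · rw [closedLoopA, Matrix.sub_mulVec, ← Matrix.mulVec_mulVec, hK, Matrix.mulVec_zero, sub_zero]

/-- Real form of the eigenvector test for observability: `x + iy` is an eigenvector for `a + ib`, so
outputs vanishing on it vanish along all powers of `A`. -/
theorem IsObservable.eq_zero_of_invariant (hG : G.IsObservable) {x y : Fin n → ℝ} {a b : ℝ}
    (hx : G.A *ᵥ x = a • x - b • y) (hy : G.A *ᵥ y = b • x + a • y)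
    (hCx : G.C *ᵥ x = 0) (hCy : G.C *ᵥ y = 0) : x = 0 ∧ y = 0 := by
  have key : ∀ k : ℕ, (G.C * G.A ^ k) *ᵥ x = 0 ∧ (G.C * G.A ^ k) *ᵥ y = 0 := by
    intro k
    induction k with
    | zero => simpa using ⟨hCx, hCy⟩
    | succ k ih =>
      rw [pow_succ, ← Matrix.mul_assoc, ← Matrix.mulVec_mulVec x _ G.A, ← Matrix.mulVec_mulVec y _ G.A, hx, hy,
        Matrix.mulVec_sub, Matrix.mulVec_add]
      simp [Matrix.mulVec_smul, ih.1, ih.2]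
  exact ⟨hG x fun k => (key k).1, hG y fun k => (key k).2⟩

/-- A positive semidefinite Riccati solution of an observable plant is stabilizing. -/
theorem IsRiccatiSolution.isHurwitz {P : Matrix (Fin n) (Fin n) ℝ} (h : G.IsRiccatiSolution P)
    (hw : G.w ≠ 0) (hG : G.IsObservable) : IsHurwitz (G.closedLoopA P) := by
  intro μ hμ
  by_contra hre
  rw [not_lt] at hre
  rw [← Matrix.spectrum_toLin', ← Module.End.hasEigenvalue_iff_mem_spectrum] at hμ
  obtain ⟨v, hv⟩ := hμ.exists_hasEigenvector
  have hv1 : (G.closedLoopA P).map (algebraMap ℝ ℂ) *ᵥ v = μ • v := by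
    simpa using hv.apply_eq_smul
  set x : Fin n → ℝ := fun i => (v i).re with hxdef
  set y : Fin n → ℝ := fun i => (v i).im with hydef
  have hx : G.closedLoopA P *ᵥ x = μ.re • x - μ.im • y := by
    funext i
    have := congrArg Complex.re (congrFun hv1 i)
    simpa [Matrix.mulVec, dotProduct, Complex.re_sum] using this
  have hy : G.closedLoopA P *ᵥ y = μ.im • x + μ.re • y := by
    funext i
    have := congrArg Complex.im (congrFun hv1 i)
    simpa [Matrix.mulVec, dotProduct, Complex.im_sum, add_comm] using this
  have ex := h.dotProduct_lyapunov x
  have ey := h.dotProduct_lyapunov y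
  have px := (Matrix.posSemidef_iff_dotProduct_mulVec.1 h.1).2 x
  have py := (Matrix.posSemidef_iff_dotProduct_mulVec.1 h.1).2 y
  rw [star_trivial] at px py
  have hxy := dotProduct_riccati_comm h.transpose_eq x y
  have nx := dotProduct_self_star_nonneg (G.closedLoopC P *ᵥ x)
  have ny := dotProduct_self_star_nonneg (G.closedLoopC P *ᵥ y)
  rw [star_trivial] at nx ny
  rw [hx, Matrix.mulVec_sub, Matrix.mulVec_smul, Matrix.mulVec_smul, dotProduct_sub,
    dotProduct_smul, dotProduct_smul, smul_eq_mul, smul_eq_mul] at ex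
  rw [hy, Matrix.mulVec_add, Matrix.mulVec_smul, Matrix.mulVec_smul, dotProduct_add,
    dotProduct_smul, dotProduct_smul, smul_eq_mul, smul_eq_mul, ← hxy] at ey
  have mx := mul_nonneg hre px
  have my := mul_nonneg hre py
  -- Adding `ex` and `ey` cancels the `μ.im` cross terms; a nonnegative quantity then equals minus
  -- the sum of the two output energies, so both vanish.
  have zx := dotProduct_self_eq_zero.1 (le_antisymm (by linarith) nx)
  have zy := dotProduct_self_eq_zero.1 (le_antisymm (by linarith) ny)
  obtain ⟨cx, ax⟩ := output_eq_zero_of_closedLoopC hw zx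
  obtain ⟨cy, ay⟩ := output_eq_zero_of_closedLoopC hw zy
  obtain ⟨x0, y0⟩ := hG.eq_zero_of_invariant (ax ▸ hx) (ay ▸ hy) cx cy
  refine hv.2 (funext fun i => Complex.ext ?_ ?_)
  · exact congrFun x0 i
  · exact congrFun y0 i

theorem IsRiccatiSolution.unique {P P' : Matrix (Fin n) (Fin n) ℝ} (h : G.IsRiccatiSolution P)
    (h' : G.IsRiccatiSolution P') (hw : G.w ≠ 0) (hG : G.IsObservable) : P' = P := by
  -- Taking one closed loop on each side makes the Sylvester expression for `P' - P` exactly the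
  -- difference of the two Riccati equations.
  refine sub_eq_zero.1 ((h'.isHurwitz hw hG).eq_zero_of_sylvester (h.isHurwitz hw hG) ?_)
  have e := h.2
  have e' := h'.2
  simp only [closedLoopA, Matrix.transpose_sub, Matrix.transpose_mul, Matrix.transpose_transpose,
    h'.transpose_eq]
  have : G.Aᵀ * P' + P' * G.A - P' * G.B * G.Bᵀ * P' =
      G.Aᵀ * P + P * G.A - P * G.B * G.Bᵀ * P := add_right_cancel (e'.trans e.symm)
  rw [← sub_eq_zero] at this
  rw [← this]
  simp only [Matrix.sub_mul, Matrix.mul_sub, Matrix.mul_assoc]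
  abel

open Filter Topology NormedSpace MeasureTheory in
/-- The squared `H₂`-norm of the closed loop is `tr (Bᵀ P B)`. -/
theorem IsRiccatiSolution.hasLQRH2Norm {P : Matrix (Fin n) (Fin n) ℝ}
    (h : G.IsRiccatiSolution P) (hw : G.w ≠ 0) (hG : G.IsObservable) :
    G.HasLQRH2Norm (√(G.Bᵀ * P * G.B).trace) := by
  refine ⟨P, h, fun P' h' => h.unique h' hw hG, h.isHurwitz hw hG, ?_⟩
  set A := G.closedLoopA P
  set C := G.closedLoopC P
  have htr : ∀ Q : Matrix (Fin n) (Fin n) ℝ, (G.Bᵀ * Q * G.B).trace =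
      ∑ i, ∑ j, G.B i 0 * Q i j * G.B j 0 := by
    intro Q
    simp only [Matrix.trace, Matrix.diag, Matrix.mul_apply, Finset.univ_unique,
      Finset.sum_singleton, Matrix.transpose_apply, Finset.sum_mul, Fin.default_eq_zero]
    exact Finset.sum_comm
  have hcont : Continuous fun Q : Matrix (Fin n) (Fin n) ℝ => (G.Bᵀ * Q * G.B).trace := by
    fun_prop
  set f : ℝ → ℝ := fun t => (G.Bᵀ * ((exp (t • A))ᵀ * P * exp (t • A)) * G.B).trace with hf
  have henergy : ∀ t, impulseEnergy A G.B C t =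
      (G.Bᵀ * ((exp (t • A))ᵀ * (Cᵀ * C) * exp (t • A)) * G.B).trace := by
    intro t
    simp only [impulseEnergy, Matrix.transpose_mul, Matrix.mul_assoc]
  have hderiv : ∀ t, HasDerivAt f (-impulseEnergy A G.B C t) t := by
    intro t
    have hd := hasDerivAt_exp_transpose_mul_mul_exp A A P t
    rw [h.lyapunov] at hd
    have hij : ∀ i j, HasDerivAt (fun t : ℝ => ((exp (t • A))ᵀ * P * exp (t • A)) i j)
        (((exp (t • A))ᵀ * -(Cᵀ * C) * exp (t • A)) i j) t := fun i j =>
      hasDerivAt_pi.1 (hasDerivAt_pi.1 hd i) j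
    rw [henergy, ← Matrix.trace_neg, ← Matrix.neg_mul, ← Matrix.mul_neg, ← Matrix.neg_mul,
      ← Matrix.mul_neg]
    simp only [hf, htr]
    exact HasDerivAt.fun_sum fun i _ => HasDerivAt.fun_sum fun j _ =>
      ((hij i j).const_mul _).mul_const _
  have hnonneg : ∀ t, 0 ≤ impulseEnergy A G.B C t := by
    intro t
    have := (Matrix.posSemidef_conjTranspose_mul_self
      (C * exp (t • A) * G.B)).trace_nonneg
    rwa [Matrix.conjTranspose_eq_transpose_of_trivial] at this
  have hlim : Tendsto f atTop (𝓝 0) := by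
    have he := (h.isHurwitz hw hG).tendsto_exp
    have hc : Continuous fun Q : Matrix (Fin n) (Fin n) ℝ =>
      (G.Bᵀ * (Qᵀ * P * Q) * G.B).trace := by fun_prop
    simpa [Function.comp_def] using (hc.tendsto 0).comp he
  -- Since `f` is monotone with a limit, integrability comes without any decay rate.
  have hint := integrableOn_Ioi_deriv_of_nonpos' (a := 0) (fun t _ => hderiv t)
    (fun t _ => neg_nonpos.2 (hnonneg t)) hlim
  have hval := integral_Ioi_of_hasDerivAt_of_nonpos' (a := 0) (fun t _ => hderiv t)
    (fun t _ => neg_nonpos.2 (hnonneg t)) hlim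
  have hf0 : f 0 = (G.Bᵀ * P * G.B).trace := by simp [hf]
  refine ⟨by simpa using hint.neg, ?_⟩
  rw [integral_neg, hf0, zero_sub, neg_inj] at hval
  rw [hval]

end Plant

/-! ### Explicit Riccati solutions for the integrator chains -/

/-- A chain of a double integrator driving a double integrator with gain `γ`, where the input
also acts on the second state with gain `α`. -/
def quadIntegrator (γ α w : ℝ) : Plant 4 where
  A := !![0, 1, 0, 0; 0, 0, γ, 0; 0, 0, 0, 1; 0, 0, 0, 0]
  B := !![0; α; 0; 1]
  C := !![1, 0, 0, 0]
  w := w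

/-- The double integrator with position output. -/
def doubleIntegrator (w : ℝ) : Plant 2 where
  A := !![0, 1; 0, 0]
  B := !![0; 1]
  C := !![1, 0]
  w := w

theorem quadIntegrator_isObservable {γ : ℝ} (hγ : γ ≠ 0) (α w : ℝ) :
    (quadIntegrator γ α w).IsObservable := by
  intro x hx
  have h0 := congrFun (hx 0) 0
  have h1 := congrFun (hx 1) 0
  have h2 := congrFun (hx 2) 0
  have h3 := congrFun (hx 3) 0
  simp [quadIntegrator, pow_succ, Matrix.mulVec, dotProduct, Fin.sum_univ_succ, hγ] at h0 h1 h2 h3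
  funext i
  fin_cases i
  · exact h0
  · exact h1
  · exact h2
  · exact h3

theorem doubleIntegrator_isObservable (w : ℝ) : (doubleIntegrator w).IsObservable := by
  intro x hx
  have h0 := congrFun (hx 0) 0
  have h1 := congrFun (hx 1) 0
  simp [doubleIntegrator, Matrix.mulVec, dotProduct, Fin.sum_univ_succ] at h0 h1
  funext i
  fin_cases i
  · exact h0
  · exact h1

/-- Upper triangular factor of the Riccati solution of `quadIntegrator`. -/
noncomputable def quadFactor (q r u : ℝ) : Matrix (Fin 4) (Fin 4) ℝ :=
  !![q, q / u, r * (r - u) / 2, r * (r - 2 * u) / (2 * u);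
     0, q, r ^ 2 * u / 2, (r ^ 2 - u * r - u ^ 2) / 2;
     0, 0, 1, 1 / u;
     0, 0, 0, 1]

/-- The stabilizing Riccati solution of `quadIntegrator`. -/
noncomputable def quadRiccati (q r u : ℝ) : Matrix (Fin 4) (Fin 4) ℝ :=
  (quadFactor q r u)ᵀ *
    Matrix.diagonal ![2 / u, 2 / (r * u ^ 2), r * u ^ 2 / 2, u / 2] * quadFactor q r u

/-- The factored form shows positivity; the expanded entries turn the Riccati equation into rational
identities. -/
theorem quadRiccati_eq {q r u : ℝ} (hr : r ≠ 0) (hu : u ≠ 0) :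
    quadRiccati q r u =
      !![2 * q ^ 2 / u, 2 * q ^ 2 / u ^ 2, q * r * (r - u) / u, q * r * (r - 2 * u) / u ^ 2;
        2 * q ^ 2 / u ^ 2, 2 * q ^ 2 * (r + u) / (r * u ^ 3), q * r ^ 2 / u ^ 2,
          q * (r ^ 3 - u * r ^ 2 - u ^ 2 * r - u ^ 3) / (r * u ^ 3);
        q * r * (r - u) / u, q * r ^ 2 / u ^ 2,
          r * (r ^ 3 - r ^ 2 * u + u ^ 2 * r + u ^ 3) / (2 * u),
          r ^ 2 * (r - u) ^ 2 / (2 * u ^ 2);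
        q * r * (r - 2 * u) / u ^ 2, q * (r ^ 3 - u * r ^ 2 - u ^ 2 * r - u ^ 3) / (r * u ^ 3),
          r ^ 2 * (r - u) ^ 2 / (2 * u ^ 2),
          (u ^ 5 + 3 * u ^ 4 * r + 2 * u ^ 2 * r ^ 3 - 3 * u * r ^ 4 + r ^ 5) /
            (2 * r * u ^ 3)] := by
  ext i j
  fin_cases i <;> fin_cases j <;>
    simp [quadRiccati, quadFactor, Matrix.mul_apply, Fin.sum_univ_succ, Matrix.diagonal] <;>
    field_simp <;> ring

/-- This is the feedback gain `K`: the quadratic Riccati term is `Kᵀ K`, and the squared norm is `K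
B`. -/
theorem transpose_quadIntegrator_B_mul_quadRiccati {q r u w : ℝ} (hq : q ≠ 0) (hr : r ≠ 0)
    (hu : u ≠ 0) :
    (quadIntegrator (r ^ 2 * u ^ 2 / (2 * q)) ((u ^ 2 + 2 * u * r - r ^ 2) / (2 * q)) w).Bᵀ *
      quadRiccati q r u = !![q, 2 * q / u, r ^ 2, r * (r - u) / u] := by
  rw [quadRiccati_eq hr hu]
  ext i j
  fin_cases i; fin_cases j <;>
    simp [quadIntegrator, Matrix.mul_apply, Fin.sum_univ_succ] <;>
    field_simp <;> ring

theorem quadRiccati_posSemidef {r u : ℝ} (q : ℝ) (hr : 0 < r) (hu : 0 < u) :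
    (quadRiccati q r u).PosSemidef := by
  have hD : (Matrix.diagonal ![2 / u, 2 / (r * u ^ 2), r * u ^ 2 / 2, u / 2]).PosSemidef := by
    rw [Matrix.posSemidef_diagonal_iff]
    intro i
    fin_cases i <;> simp <;> positivity
  have := hD.conjTranspose_mul_mul_same (quadFactor q r u)
  rwa [Matrix.conjTranspose_eq_transpose_of_trivial] at this

theorem quadRiccati_isRiccatiSolution {q r u w : ℝ} (hq : q ≠ 0) (hr : 0 < r) (hu : 0 < u)
    (hw : w ^ 2 = q ^ 2) :
    (quadIntegrator (r ^ 2 * u ^ 2 / (2 * q)) ((u ^ 2 + 2 * u * r - r ^ 2) / (2 * q))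
      w).IsRiccatiSolution (quadRiccati q r u) := by
  have hP := quadRiccati_posSemidef q hr hu
  refine ⟨hP, ?_⟩
  have hK := transpose_quadIntegrator_B_mul_quadRiccati (w := w) hq hr.ne' hu.ne'
  have hsymm : (quadRiccati q r u)ᵀ = quadRiccati q r u := by
    have := hP.isHermitian
    rwa [Matrix.IsHermitian, Matrix.conjTranspose_eq_transpose_of_trivial] at this
  have hK' := congrArg Matrix.transpose hK
  rw [Matrix.transpose_mul, Matrix.transpose_transpose, hsymm] at hK'
  rw [Matrix.mul_assoc _ _ (quadRiccati q r u), hK, hK', quadRiccati_eq hr.ne' hu.ne']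
  have hw' : (quadIntegrator (r ^ 2 * u ^ 2 / (2 * q)) ((u ^ 2 + 2 * u * r - r ^ 2) / (2 * q))
      w).w ^ 2 = q ^ 2 := hw
  rw [hw']
  have hr' := hr.ne'
  have hu' := hu.ne'
  ext i j
  fin_cases i <;> fin_cases j <;>
    simp [quadIntegrator, Matrix.mul_apply, Fin.sum_univ_succ] <;>
    field_simp <;> ring

theorem quadIntegrator_hasLQRH2Norm_of_param {q r u w : ℝ} (hq : q ≠ 0) (hr : 0 < r) (hu : 0 < u)
    (hw : w ^ 2 = q ^ 2) :
    (quadIntegrator (r ^ 2 * u ^ 2 / (2 * q)) ((u ^ 2 + 2 * u * r - r ^ 2) / (2 * q))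
      w).HasLQRH2Norm (√(r + u)) := by
  have hw0 : w ≠ 0 := fun h => hq (by simpa [h, eq_comm] using hw)
  have h := (quadRiccati_isRiccatiSolution hq hr hu hw).hasLQRH2Norm hw0
    (quadIntegrator_isObservable (by positivity) _ _)
  rw [transpose_quadIntegrator_B_mul_quadRiccati hq hr.ne' hu.ne'] at h
  convert h using 2
  simp [quadIntegrator, Matrix.trace]
  field_simp
  ring

theorem doubleIntegrator_hasLQRH2Norm {w : ℝ} (hw : 0 < w) :
    (doubleIntegrator w).HasLQRH2Norm (√(√(2 * w))) := by
  -- `s² + x s + w` is the stable factor of `s⁴ + w²`, so the gain is `(w, x)`.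
  obtain ⟨x, hx, hx2⟩ : ∃ x : ℝ, 0 < x ∧ x ^ 2 = 2 * w :=
    ⟨√(2 * w), by positivity, Real.sq_sqrt (by positivity)⟩
  have hP : (!![w * x, w; w, x] : Matrix (Fin 2) (Fin 2) ℝ).PosSemidef := by
    have hD : (Matrix.diagonal ![x ^ 3 / 2, x / 2]).PosSemidef := by
      rw [Matrix.posSemidef_diagonal_iff]
      intro i
      fin_cases i <;> simp <;> positivity
    have := hD.conjTranspose_mul_mul_same (!![1, 1 / x; 0, 1] : Matrix (Fin 2) (Fin 2) ℝ)
    rw [Matrix.conjTranspose_eq_transpose_of_trivial] at this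
    obtain rfl : w = x ^ 2 / 2 := by linarith
    convert this using 1
    ext i j
    fin_cases i <;> fin_cases j <;>
      simp [Matrix.mul_apply, Fin.sum_univ_succ, Matrix.diagonal] <;> field_simp <;> ring
  have hR : (doubleIntegrator w).IsRiccatiSolution !![w * x, w; w, x] := by
    refine ⟨hP, ?_⟩
    have hK : (doubleIntegrator w).Bᵀ * !![w * x, w; w, x] = !![w, x] := by
      ext i j
      fin_cases i; fin_cases j <;> simp [doubleIntegrator, Matrix.mul_apply]
    rw [Matrix.mul_assoc _ _ !![w * x, w; w, x], hK]
    ext i j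
    fin_cases i <;> fin_cases j <;>
      simp [doubleIntegrator, Matrix.mul_apply, Fin.sum_univ_succ] <;> linarith
  have h := hR.hasLQRH2Norm hw.ne' (doubleIntegrator_isObservable w)
  convert h using 2
  rw [← hx2, Real.sqrt_sq hx.le]
  simp [doubleIntegrator, Matrix.trace, Matrix.mul_apply, Fin.sum_univ_succ]

theorem two_mul_sub_add_div_eq {Γ β t r q : ℝ} (hq : 0 < q) (hr : 0 < r) (ht : r ^ 2 = t)
    {s : ℝ} (hs : t = Γ - β + s) :
    (2 * (q ^ 3 * Γ) - q ^ 3 * β + q ^ 3 * s) /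
      (q * √q * √(q ^ 3 * Γ - q ^ 3 * β + q ^ 3 * s)) = r + Γ / r := by
  obtain ⟨p, hp, rfl⟩ : ∃ p : ℝ, 0 < p ∧ q = p ^ 2 :=
    ⟨√q, by positivity, (Real.sq_sqrt hq.le).symm⟩
  have e : (p ^ 2) ^ 3 * Γ - (p ^ 2) ^ 3 * β + (p ^ 2) ^ 3 * s = (p ^ 3 * r) ^ 2 := by
    rw [mul_pow, ht, hs]; ring
  rw [e, Real.sqrt_sq hp.le, Real.sqrt_sq (by positivity)]
  obtain rfl : s = r ^ 2 - Γ + β := by linarith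
  field_simp
  ring

/-- The closed-form squared `H₂`-norm of the chain of integrators; the sign `ε` covers both
horizontal directions. -/
theorem quadIntegrator_hasLQRH2Norm {g q ε : ℝ} (α : ℝ) (hg : 0 < g) (hq : 0 < q)
    (hε : ε ^ 2 = 1) {a b σ : ℝ} (ha : a = √(2 * g * q ^ 7)) (hb : b = α * q ^ 4)
    (hσ : σ = √((a - b) ^ 2 + a ^ 2)) :
    (quadIntegrator (ε * g) (ε * α) q).HasLQRH2Norm
      (√((2 * a - b + σ) / (q * √q * √(a - b + σ)))) := by
  obtain ⟨Γ, hΓ, hΓ2⟩ : ∃ Γ : ℝ, 0 < Γ ∧ Γ ^ 2 = 2 * g * q :=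
    ⟨√(2 * g * q), by positivity, Real.sq_sqrt (by positivity)⟩
  have ha' : a = q ^ 3 * Γ := by
    rw [ha, show 2 * g * q ^ 7 = (q ^ 3 * Γ) ^ 2 by rw [mul_pow, hΓ2]; ring,
      Real.sqrt_sq (by positivity)]
  have hb' : b = q ^ 3 * (q * α) := by rw [hb]; ring
  set s := √((Γ - q * α) ^ 2 + Γ ^ 2) with hs
  have hs2 : s ^ 2 = (Γ - q * α) ^ 2 + Γ ^ 2 := Real.sq_sqrt (by positivity)
  have hσ' : σ = q ^ 3 * s := by
    rw [hσ, ha', hb', show (q ^ 3 * Γ - q ^ 3 * (q * α)) ^ 2 + (q ^ 3 * Γ) ^ 2 = (q ^ 3 * s) ^ 2 by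
      rw [mul_pow _ s, hs2]; ring, Real.sqrt_sq (by positivity)]
  have ht : 0 < Γ - q * α + s := by
    have : |Γ - q * α| < s := by
      rw [hs, ← Real.sqrt_sq_eq_abs]
      exact Real.sqrt_lt_sqrt (sq_nonneg _) (by nlinarith)
    linarith [neg_abs_le (Γ - q * α)]
  -- Eliminating `u` by `ru = Γ` leaves a quadratic in `r²`, of which this is the positive root.
  obtain ⟨r, hr, hr2⟩ : ∃ r : ℝ, 0 < r ∧ r ^ 2 = Γ - q * α + s :=
    ⟨√(Γ - q * α + s), by positivity, Real.sq_sqrt ht.le⟩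
  have hε0 : ε ≠ 0 := by rintro rfl; norm_num at hε
  -- The sign goes into the parameter `ε * q`; the cost sees only its square.
  have h := quadIntegrator_hasLQRH2Norm_of_param (w := q) (mul_ne_zero hε0 hq.ne') hr
    (div_pos hΓ hr) (by rw [mul_pow, hε, one_mul])
  rw [ha', hb', hσ', two_mul_sub_add_div_eq hq hr hr2 rfl]
  convert h using 2
  · field_simp
    rw [hε, hΓ2]; ring
  · have hrel : r ^ 4 - 2 * (Γ - q * α) * r ^ 2 = Γ ^ 2 := by
      rw [show r ^ 4 = (r ^ 2) ^ 2 by ring, hr2]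
      linear_combination hs2
    field_simp
    rw [hε]
    linear_combination hrel

namespace Params

theorem inputScale_pos (S : Params) (i : Fin 4) : 0 < S.inputScale i := by
  have h1 := S.mUAV_pos
  have h2 := S.mPL_nonneg
  have h3 := S.Hxx_pos
  have h4 := S.Hyy_pos
  have h5 := S.Hzz_pos
  have hm : 0 < S.mtot := by unfold mtot; positivity
  fin_cases i <;> simp [inputScale] <;> positivity

theorem qhat_pos (S : Params) (i : Fin 4) : 0 < S.qhat i :=
  mul_pos (S.inputScale_pos i) (S.q_pos i)

end Params

end UAVPayload

theorem mainTheorem2 (S : UAVPayload.Params) :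
    (UAVPayload.subsystem1 S).HasLQRH2Norm
      (√((2 * S.a 0 - S.b 0 + S.sigma 0) /
        (S.qhat 0 * √(S.qhat 0) * √(S.a 0 - S.b 0 + S.sigma 0)))) ∧
    (UAVPayload.subsystem2 S).HasLQRH2Norm
      (√((2 * S.a 1 - S.b 1 + S.sigma 1) /
        (S.qhat 1 * √(S.qhat 1) * √(S.a 1 - S.b 1 + S.sigma 1)))) ∧
    (UAVPayload.subsystem3 S).HasLQRH2Norm (√(√(2 * S.qhat 2))) ∧
    (UAVPayload.subsystem4 S).HasLQRH2Norm (√(√(2 * S.qhat 3))) := by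
  refine ⟨?_, ?_, UAVPayload.doubleIntegrator_hasLQRH2Norm (S.qhat_pos 2),
    UAVPayload.doubleIntegrator_hasLQRH2Norm (S.qhat_pos 3)⟩
  · have h := UAVPayload.quadIntegrator_hasLQRH2Norm (ε := 1) (a := S.a 0) (b := S.b 0)
      (σ := S.sigma 0) S.alpha S.g_pos (S.qhat_pos 0) (by norm_num) rfl rfl rfl
    rwa [one_mul, one_mul] at h
  · have h := UAVPayload.quadIntegrator_hasLQRH2Norm (ε := -1) (a := S.a 1) (b := S.b 1)
      (σ := S.sigma 1) S.alpha S.g_pos (S.qhat_pos 1) (by norm_num) rfl rfl rfl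
    rwa [neg_one_mul, neg_one_mul] at h
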